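/- Let $(G,\star)$ be a monoid with neutral element $e$, and write $g_1\preceq g_2$ if there is $h\in G$ with $h\star g_1=g_2$, and $g_1\prec g_2$ if moreover $g_1\ne g_2$. A common multiple of $H\subseteq G$ is an element $h\in G$ with $g\preceq h$ for all $g\in H$; it is partially least if no common multiple $h'$ of $H$ satisfies $h'\prec h$. Assume that $G$ is good, that is: $G$ is left- and right-cancellative; $g_1\preceq g_2$ and $g_2\preceq g_1$ imply $g_1=g_2$; and every finite subset of $G$ has at most finitely many partially least common multiples. Let $R$ be a (not necessarily commutative) ring with unity such that $R$ and the monoid ring $R[G]=\bigoplus_{g\in G}R\,X^g$ are left Noetherian (for instance, Noetherian on both sides). Modules are left modules. A $G$-graded $R[G]$-module is a family of abelian groups $(M_g)_{g\in G}$ together with an $R[G]$-module structure on $\bigoplus_{g\in G}M_g$ such that $(R\,X^{g})\,M_{h}\subseteq M_{g\star h}$ for all $g,h\in G$; morphisms are the $R[G]$-linear maps $f$ with $f(M_g)\subseteq N_g$ for all $g$. It is finitely generated if $\bigoplus_g M_g$ is a finitely generated $R[G]$-module. A generalized algebraic persistence module over $R$ indexed by $G$ is a family of $R$-modules $(M_g)_{g\in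 G}$ with $R$-linear maps $\varphi_{g_1,g_2}\colon M_{g_1}\to M_{g_2}$ for $g_1\preceq g_2$, such that $\varphi_{g,g}=\mathrm{id}$ and $\varphi_{g_1,g_3}=\varphi_{g_2,g_3}\circ\varphi_{g_1,g_2}$ for $g_1\preceq g_2\preceq g_3$; morphisms are families of $R$-linear maps $\xi_g\colon M_g\to N_g$ commuting with the maps $\varphi$. An element $h\in G$ is a frame of $g\in G$ if $h\preceq g$ and $\varphi_{h,\tilde g}$ is an isomorphism for all $\tilde g$ with $h\preceq\tilde g\preceq g$. The persistence module is of finitely generated type if every $M_g$ is a finitely generated $R$-module and there is a finite set $H\subseteq G$ such that every $g\in G$ has a frame in $H$. Then the category of finitely generated $G$-graded $R[G]$-modules and the category of generalized algebraic persistence modules over $R$ indexed by $G$ of finitely generated type (full subcategories of the categories above) are isomorphic: there are functors between them in both directions whose two composites are equal to the identity functors. -/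

import Mathlib

open CategoryTheory
open scoped DirectSum

universe u v w

section Monoids

variable {G : Type v} [Monoid G]

/-- `g₁ ⪯ g₂`: the element `g₂` is a (left-)multiple of `g₁`. -/
def LeftMultiple (g₁ g₂ : G) : Prop := ∃ h : G, h * g₁ = g₂

theorem LeftMultiple.refl (g : G) : LeftMultiple g g := ⟨1, one_mul g⟩

theorem LeftMultiple.trans {g₁ g₂ g₃ : G} (h₁ : LeftMultiple g₁ g₂) (h₂ : LeftMultiple g₂ g₃) :
    LeftMultiple g₁ g₃ := by
  obtain ⟨a, rfl⟩ := h₁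
  obtain ⟨b, rfl⟩ := h₂
  exact ⟨b * a, mul_assoc b a g₁⟩

/-- `h` is a common multiple of the set `H`. -/
def IsCommonMultiple (H : Set G) (h : G) : Prop := ∀ g ∈ H, LeftMultiple g h

/-- `h` is a partially least common multiple of `H`: a common multiple such that no common
multiple `h'` of `H` satisfies `h' ≺ h`, i.e. `h' ⪯ h` and `h' ≠ h`. -/
def IsPartiallyLeastCommonMultiple (H : Set G) (h : G) : Prop :=
  IsCommonMultiple H h ∧ ∀ h' : G, IsCommonMultiple H h' → ¬ (LeftMultiple h' h ∧ h' ≠ h)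

variable (G) in
/-- A monoid is good if it is cancellative (on both sides), anti-symmetric and weak plcm. -/
structure IsGoodMonoid : Prop where
  cancel : IsCancelMul G
  antisymm : ∀ g₁ g₂ : G, LeftMultiple g₁ g₂ → LeftMultiple g₂ g₁ → g₁ = g₂
  weak_plcm : ∀ H : Set G, H.Finite → {h : G | IsPartiallyLeastCommonMultiple H h}.Finite

end Monoids

section GradedModules

/-- The element `x` of `⨁ g, M g` lies in the summand `M g`. -/
def IsHomogeneousOfDegree {G : Type v} {M : G → Type w} [∀ g, AddCommGroup (M g)]
    (g : G) (x : ⨁ g, M g) : Prop :=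
  ∀ h : G, h ≠ g → x h = 0

/-- A `G`-graded (left) module over the monoid ring `R[G]`: a family of abelian groups
`M g` and an `R[G]`-module structure on `⨁ g, M g` such that
`R[G]_g • M h ⊆ M (g * h)`, where `R[G]_g = {r X^g | r ∈ R}`. -/
structure GradedMonoidRingModule (R : Type u) (G : Type v) [Ring R] [Monoid G] where
  component : G → Type w
  [addCommGroup : ∀ g, AddCommGroup (component g)]
  [module : Module (MonoidAlgebra R G) (⨁ g, component g)]
  smul_homogeneous : ∀ (g h : G) (r : R) (x : ⨁ g, component g),
    IsHomogeneousOfDegree h x →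
      IsHomogeneousOfDegree (g * h) ((MonoidAlgebra.single g r : MonoidAlgebra R G) • x)

attribute [instance] GradedMonoidRingModule.addCommGroup GradedMonoidRingModule.module

namespace GradedMonoidRingModule

variable {R : Type u} {G : Type v} [Ring R] [Monoid G]

/-- A graded morphism: an `R[G]`-linear map with `f (M g) ⊆ N g` for all `g`. -/
@[ext]
structure Hom (M N : GradedMonoidRingModule.{u, v, w} R G) where
  toLinearMap : (⨁ g, M.component g) →ₗ[MonoidAlgebra R G] (⨁ g, N.component g)
  map_homogeneous : ∀ (g : G) (x : ⨁ g, M.component g),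
    IsHomogeneousOfDegree g x → IsHomogeneousOfDegree g (toLinearMap x)

/-- The category of `G`-graded `R[G]`-modules and graded morphisms. -/
noncomputable instance : Category (GradedMonoidRingModule.{u, v, w} R G) where
  Hom := Hom
  id M := ⟨LinearMap.id, fun _ _ hx => hx⟩
  comp f f' := ⟨f'.toLinearMap ∘ₗ f.toLinearMap,
    fun g x hx => f'.map_homogeneous g _ (f.map_homogeneous g x hx)⟩

variable (R G) in
/-- The graded `R[G]`-modules that are finitely generated as `R[G]`-modules. -/
def finitelyGenerated : ObjectProperty (GradedMonoidRingModule.{u, v, w} R G) :=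
  fun M => Module.Finite (MonoidAlgebra R G) (⨁ g, M.component g)

end GradedMonoidRingModule

end GradedModules

section PersistenceModules

/-- A generalized algebraic persistence module over `R`, indexed by the monoid `G`. -/
structure GenPersistenceModule (R : Type u) (G : Type v) [Ring R] [Monoid G] where
  component : G → Type w
  [addCommGroup : ∀ g, AddCommGroup (component g)]
  [module : ∀ g, Module R (component g)]
  map : ∀ {g₁ g₂ : G}, LeftMultiple g₁ g₂ → (component g₁ →ₗ[R] component g₂)
  map_refl : ∀ g : G, map (LeftMultiple.refl g) = LinearMap.id
  map_trans : ∀ {g₁ g₂ g₃ : G} (h₁ : LeftMultiple g₁ g₂) (h₂ : LeftMultiple g₂ g₃),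
    map (h₁.trans h₂) = map h₂ ∘ₗ map h₁

attribute [instance] GenPersistenceModule.addCommGroup GenPersistenceModule.module

namespace GenPersistenceModule

variable {R : Type u} {G : Type v} [Ring R] [Monoid G]

/-- A morphism of persistence modules: a family of `R`-linear maps that commutes with the
connecting maps. -/
@[ext]
structure Hom (M N : GenPersistenceModule.{u, v, w} R G) where
  app : ∀ g : G, M.component g →ₗ[R] N.component g
  naturality : ∀ {g₁ g₂ : G} (h : LeftMultiple g₁ g₂),
    N.map h ∘ₗ app g₁ = app g₂ ∘ₗ M.map h

/-- The category of generalized algebraic persistence modules over `R` indexed by `G`. -/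
instance : Category (GenPersistenceModule.{u, v, w} R G) where
  Hom := Hom
  id M := ⟨fun _ => LinearMap.id, fun _ => rfl⟩
  comp f f' := ⟨fun g => f'.app g ∘ₗ f.app g, fun {g₁ g₂} h => by
    rw [← LinearMap.comp_assoc, f'.naturality h, LinearMap.comp_assoc, f.naturality h,
      LinearMap.comp_assoc]⟩

/-- `h` is a frame of `g`: `h ⪯ g`, and the connecting map from `h` to `k` is an isomorphism
whenever `h ⪯ k ⪯ g`. -/
def IsFrame (M : GenPersistenceModule.{u, v, w} R G) (h g : G) : Prop :=
  LeftMultiple h g ∧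
    ∀ (k : G) (hk : LeftMultiple h k), LeftMultiple k g → Function.Bijective (M.map hk)

/-- `H` is a framing set: every element of `G` has a frame in `H`. -/
def IsFramingSet (M : GenPersistenceModule.{u, v, w} R G) (H : Set G) : Prop :=
  ∀ g : G, ∃ h ∈ H, M.IsFrame h g

/-- `M` is of finite type: it has a finite framing set. -/
def IsFiniteType (M : GenPersistenceModule.{u, v, w} R G) : Prop :=
  ∃ H : Set G, H.Finite ∧ M.IsFramingSet H

variable (R G) in
/-- The persistence modules of finitely generated type: those of finite type all of whose
components are finitely generated `R`-modules. -/
def finitelyGeneratedType : ObjectProperty (GenPersistenceModule.{u, v, w} R G) :=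
  fun M => M.IsFiniteType ∧ ∀ g : G, Module.Finite R (M.component g)

end GenPersistenceModule

end PersistenceModules

/-- Two categories are isomorphic if there are functors between them in both directions whose
composites are equal to the identity functors. -/
def AreIsomorphicCategories (C : Type*) (D : Type*) [Category* C] [Category* D] : Prop :=
  ∃ (F : C ⥤ D) (F' : D ⥤ C), F ⋙ F' = 𝟭 C ∧ F' ⋙ F = 𝟭 D

/-! ### Isomorphism of the two ambient categories -/

section CorrespondenceOfCategories

open scoped Classical

/-! A persistence module becomes a graded module by letting `r X^c` act from degree `g` to `c * g`
as `r` times the connecting map. Conversely, `r X^1` gives the `R`-structure on each component, and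
the connecting map from `g` to `k` is multiplication by `X^c` with `c * g = k`; right cancellation
makes `c` unique. Neither passage changes the underlying family of groups, so the composites are
equal to the identities.

It remains to match the finiteness conditions. If every degree has a frame in a finite set `H`,
generators of the components over `H` generate everything, since the maps out of frames are
surjective.

Conversely, choose finitely many homogeneous generators, of degrees `d i`. The component at `g` is
the module of vectors supported on the `i` with `d i ⪯ g`, modulo relations `K g`. The `K g`
increase with `g`, so they assemble into a submodule of a free `R[G]`-module of finite rank; by
Noetherianity they are generated in a finite set `E` of degrees (`exists_finite_forall_le_iSup`). If
`h ⪯ g` and the same elements of `E` and the same `d i` divide both, generators and relations do not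
change between `h` and `g`, so `h` is a frame of `g` (`bijective_map_of_generators`). Partially
least common multiples of subsets of `E ∪ {d i}` supply finitely many such `h`
(`IsGoodMonoid.exists_finite_set_of_divisors`). -/

theorem LeftMultiple.mul_left {G : Type v} [Monoid G] (c g : G) : LeftMultiple g (c * g) :=
  ⟨c, rfl⟩

theorem IsHomogeneousOfDegree.of_apply_eq {G : Type v} {M : G → Type w}
    [∀ g, AddCommGroup (M g)] {g : G} {x : ⨁ g, M g} (hx : IsHomogeneousOfDegree g x) :
    DirectSum.of M g (x g) = x := by
  ext h
  by_cases hh : h = g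
  · subst hh
    rw [DirectSum.of_eq_same]
  · rw [DirectSum.of_eq_of_ne _ _ _ hh, hx h hh]

theorem isHomogeneousOfDegree_of {G : Type v} {M : G → Type w} [∀ g, AddCommGroup (M g)]
    (g : G) (x : M g) :
    IsHomogeneousOfDegree g (DirectSum.of M g x) :=
  fun _ hh => DirectSum.of_eq_of_ne _ _ _ hh

variable {R : Type u} {G : Type v} [Ring R] [Monoid G]

/-! ### From persistence modules to graded modules -/

namespace GenPersistenceModule

/-- Components in propositionally equal degrees are different types. Comparing elements inside the
direct sum absorbs identities such as `1 * g = g` without transport. -/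
theorem of_map_eq_of_map (P : GenPersistenceModule.{u, v, w} R G) {g g₁ g₂ : G}
    (h₁ : LeftMultiple g g₁) (h₂ : LeftMultiple g g₂) (h : g₁ = g₂) (x : P.component g) :
    DirectSum.of P.component g₁ (P.map h₁ x) = DirectSum.of P.component g₂ (P.map h₂ x) := by
  subst h
  rfl

theorem map_map (P : GenPersistenceModule.{u, v, w} R G) {g₁ g₂ g₃ : G}
    (h₁ : LeftMultiple g₁ g₂) (h₂ : LeftMultiple g₂ g₃) (x : P.component g₁) :
    P.map h₂ (P.map h₁ x) = P.map (h₁.trans h₂) x := by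
  rw [P.map_trans h₁ h₂]
  rfl

theorem map_self (P : GenPersistenceModule.{u, v, w} R G) {g : G} (h : LeftMultiple g g)
    (x : P.component g) : P.map h x = x :=
  LinearMap.congr_fun (P.map_refl g) x

/-- Multiplication by the monomial `X ^ c` on the direct sum of a persistence module. -/
noncomputable def shift (P : GenPersistenceModule.{u, v, w} R G) (c : G) :
    (⨁ g, P.component g) →+ ⨁ g, P.component g :=
  DirectSum.toAddMonoid fun g =>
    (DirectSum.of P.component (c * g)).comp (P.map (.mul_left c _)).toAddMonoidHom

theorem shift_of (P : GenPersistenceModule.{u, v, w} R G) (c g : G) (x : P.component g) :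
    P.shift c (DirectSum.of P.component g x) =
      DirectSum.of P.component (c * g) (P.map (.mul_left c _) x) := by
  simp [shift]

/-- The monoid acts on the direct sum of a persistence module. -/
noncomputable def shiftHom (P : GenPersistenceModule.{u, v, w} R G) :
    G →* AddMonoid.End (⨁ g, P.component g) where
  toFun := P.shift
  map_one' := by
    refine DirectSum.addHom_ext fun g x => ?_
    rw [shift_of, P.of_map_eq_of_map _ (LeftMultiple.refl g) (one_mul g), P.map_self]
    rfl
  map_mul' a b := by
    refine DirectSum.addHom_ext fun g x => ?_
    rw [shift_of]
    change _ = P.shift a (P.shift b (DirectSum.of P.component g x))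
    rw [shift_of, shift_of, map_map]
    exact P.of_map_eq_of_map _ _ (mul_assoc a b g) x

/-- This is the `R`-linearity of the connecting maps, in the form needed to extend the actions of
`R` and `G` to the monoid ring. -/
theorem commute_shiftHom (P : GenPersistenceModule.{u, v, w} R G) (r : R) (c : G) :
    Commute (Module.toAddMonoidEnd R (⨁ g, P.component g) r) (P.shiftHom c) := by
  refine DirectSum.addHom_ext fun g x => ?_
  change r • P.shift c (DirectSum.of P.component g x) =
    P.shift c (r • DirectSum.of P.component g x)
  rw [shift_of, ← DirectSum.of_smul, ← DirectSum.of_smul, shift_of, LinearMap.map_smul]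

/-- The module structure over the monoid ring on the direct sum of a persistence module. -/
noncomputable abbrev monoidAlgebraModule (P : GenPersistenceModule.{u, v, w} R G) :
    Module (MonoidAlgebra R G) (⨁ g, P.component g) :=
  Module.compHom _ (MonoidAlgebra.liftNCRingHom (Module.toAddMonoidEnd R (⨁ g, P.component g))
    P.shiftHom P.commute_shiftHom)

theorem single_smul (P : GenPersistenceModule.{u, v, w} R G) (c : G) (r : R)
    (x : ⨁ g, P.component g) :
    letI := P.monoidAlgebraModule
    (MonoidAlgebra.single c r : MonoidAlgebra R G) • x = r • P.shift c x := by
  change (MonoidAlgebra.liftNCRingHom (Module.toAddMonoidEnd R (⨁ g, P.component g))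
    P.shiftHom P.commute_shiftHom (MonoidAlgebra.single c r)) x = _
  rw [MonoidAlgebra.liftNCRingHom_single]
  rfl

theorem single_smul_of (P : GenPersistenceModule.{u, v, w} R G) (c : G) (r : R) (g : G)
    (x : P.component g) :
    letI := P.monoidAlgebraModule
    (MonoidAlgebra.single c r : MonoidAlgebra R G) • DirectSum.of P.component g x =
      DirectSum.of P.component (c * g) (r • P.map (.mul_left c _) x) := by
  rw [single_smul, shift_of, DirectSum.of_smul]

/-- The graded module over the monoid ring that is the direct sum of a persistence module. -/
noncomputable def toGraded (P : GenPersistenceModule.{u, v, w} R G) :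
    GradedMonoidRingModule.{u, v, w} R G where
  component := P.component
  module := P.monoidAlgebraModule
  smul_homogeneous c g r x hx := by
    rw [← hx.of_apply_eq, single_smul_of]
    exact isHomogeneousOfDegree_of _ _

theorem toGraded_single_smul_of (P : GenPersistenceModule.{u, v, w} R G) (c : G) (r : R) (g : G)
    (x : P.component g) :
    (MonoidAlgebra.single c r : MonoidAlgebra R G) •
        DirectSum.of P.toGraded.component g x =
      DirectSum.of P.component (c * g) (r • P.map (.mul_left c _) x) :=
  P.single_smul_of c r g x

theorem toGraded_single_one_smul_of (P : GenPersistenceModule.{u, v, w} R G) (r : R) (g : G)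
    (x : P.component g) :
    (MonoidAlgebra.single 1 r : MonoidAlgebra R G) • DirectSum.of P.toGraded.component g x =
      DirectSum.of P.component g (r • x) := by
  rw [toGraded_single_smul_of, ← LinearMap.map_smul,
    P.of_map_eq_of_map _ (LeftMultiple.refl g) (one_mul g), P.map_self]

end GenPersistenceModule

/-! ### From graded modules to persistence modules -/

namespace GradedMonoidRingModule

/-- An additive map that commutes with the scalar multiplication of homogeneous elements by
monomials is linear over the monoid ring. -/
theorem map_smul_of_map_single_smul_of {M N : GradedMonoidRingModule.{u, v, w} R G}
    (f : (⨁ g, M.component g) →+ ⨁ g, N.component g)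
    (hf : ∀ (c : G) (r : R) (g : G) (x : M.component g),
      f ((MonoidAlgebra.single c r : MonoidAlgebra R G) • DirectSum.of M.component g x) =
        (MonoidAlgebra.single c r : MonoidAlgebra R G) • f (DirectSum.of M.component g x))
    (a : MonoidAlgebra R G) (x : ⨁ g, M.component g) : f (a • x) = a • f x := by
  induction a using MonoidAlgebra.induction_linear with
  | zero => simp
  | add a b ha hb => rw [add_smul, add_smul, map_add, ha, hb]
  | single c r =>
    induction x using DirectSum.induction_on with
    | zero => simp
    | of g x => exact hf c r g x
    | add x y hx hy => rw [smul_add, map_add, map_add, smul_add, hx, hy]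

theorem of_smul_of_apply (M : GradedMonoidRingModule.{u, v, w} R G) (c : G) (r : R) {g k : G}
    (h : c * g = k) (x : M.component g) :
    DirectSum.of M.component k
        (((MonoidAlgebra.single c r : MonoidAlgebra R G) • DirectSum.of M.component g x) k) =
      (MonoidAlgebra.single c r : MonoidAlgebra R G) • DirectSum.of M.component g x := by
  subst h
  exact (M.smul_homogeneous c g r _ (isHomogeneousOfDegree_of g x)).of_apply_eq

/-- Every component of a graded module is a module over the ring of coefficients. -/
noncomputable abbrev componentModule (M : GradedMonoidRingModule.{u, v, w} R G) (g : G) :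
    Module R (M.component g) where
  smul r x := ((MonoidAlgebra.single 1 r : MonoidAlgebra R G) • DirectSum.of M.component g x) g
  one_smul x := by
    change ((1 : MonoidAlgebra R G) • DirectSum.of M.component g x) g = x
    rw [one_smul, DirectSum.of_eq_same]
  mul_smul r s x := by
    change ((MonoidAlgebra.single 1 (r * s) : MonoidAlgebra R G) • DirectSum.of M.component g x) g =
      ((MonoidAlgebra.single 1 r : MonoidAlgebra R G) • DirectSum.of M.component g
        (((MonoidAlgebra.single 1 s : MonoidAlgebra R G) • DirectSum.of M.component g x) g)) g
    rw [M.of_smul_of_apply _ _ (one_mul g), smul_smul, MonoidAlgebra.single_mul_single, one_mul]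
  smul_zero r := by
    change ((MonoidAlgebra.single 1 r : MonoidAlgebra R G) • DirectSum.of M.component g 0) g = 0
    rw [map_zero, smul_zero, DirectSum.zero_apply]
  smul_add r x y := by
    change ((MonoidAlgebra.single 1 r : MonoidAlgebra R G) • DirectSum.of M.component g (x + y)) g =
      ((MonoidAlgebra.single 1 r : MonoidAlgebra R G) • DirectSum.of M.component g x) g +
      ((MonoidAlgebra.single 1 r : MonoidAlgebra R G) • DirectSum.of M.component g y) g
    rw [map_add, smul_add, DirectSum.add_apply]
  add_smul r s x := by
    change ((MonoidAlgebra.single 1 (r + s) : MonoidAlgebra R G) • DirectSum.of M.component g x) g =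
      ((MonoidAlgebra.single 1 r : MonoidAlgebra R G) • DirectSum.of M.component g x) g +
      ((MonoidAlgebra.single 1 s : MonoidAlgebra R G) • DirectSum.of M.component g x) g
    rw [MonoidAlgebra.single_add, add_smul, DirectSum.add_apply]
  zero_smul x := by
    change ((MonoidAlgebra.single 1 0 : MonoidAlgebra R G) • DirectSum.of M.component g x) g = 0
    rw [MonoidAlgebra.single_zero, zero_smul, DirectSum.zero_apply]

theorem componentModule_smul (M : GradedMonoidRingModule.{u, v, w} R G) (g : G) (r : R)
    (x : M.component g) :
    letI := M.componentModule g
    r • x = ((MonoidAlgebra.single 1 r : MonoidAlgebra R G) • DirectSum.of M.component g x) g :=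
  rfl

theorem of_componentModule_smul (M : GradedMonoidRingModule.{u, v, w} R G) (g : G) (r : R)
    (x : M.component g) :
    letI := M.componentModule g
    DirectSum.of M.component g (r • x) =
      (MonoidAlgebra.single 1 r : MonoidAlgebra R G) • DirectSum.of M.component g x := by
  rw [componentModule_smul, M.of_smul_of_apply _ _ (one_mul g)]

/-- Multiplication by a monomial, as a map between components of a graded module. -/
noncomputable def componentMap (M : GradedMonoidRingModule.{u, v, w} R G) {g k : G}
    (h : LeftMultiple g k) :
    letI := M.componentModule
    M.component g →ₗ[R] M.component k :=
  letI := M.componentModule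
  { toFun x :=
      ((MonoidAlgebra.single h.choose 1 : MonoidAlgebra R G) • DirectSum.of M.component g x) k
    map_add' x y := by rw [map_add, smul_add, DirectSum.add_apply]
    map_smul' r x := by
      rw [of_componentModule_smul, RingHom.id_apply, componentModule_smul,
        M.of_smul_of_apply _ _ h.choose_spec, smul_smul, smul_smul,
        MonoidAlgebra.single_mul_single, MonoidAlgebra.single_mul_single]
      simp only [mul_one, one_mul] }

/-- By right cancellation the chosen factor is the only one, so any witness `c` computes the map.
Functoriality of the connecting maps rests on this. -/
theorem of_componentMap [IsRightCancelMul G] (M : GradedMonoidRingModule.{u, v, w} R G) {c g k : G}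
    (h : LeftMultiple g k) (hc : c * g = k) (x : M.component g) :
    DirectSum.of M.component k (M.componentMap h x) =
      (MonoidAlgebra.single c 1 : MonoidAlgebra R G) • DirectSum.of M.component g x := by
  have hch : h.choose = c := mul_right_cancel (h.choose_spec.trans hc.symm)
  rw [← hch]
  exact M.of_smul_of_apply _ _ h.choose_spec x

/-- The persistence module formed by the components of a graded module. -/
noncomputable def toPersistence [IsRightCancelMul G] (M : GradedMonoidRingModule.{u, v, w} R G) :
    GenPersistenceModule.{u, v, w} R G :=
  letI := M.componentModule
  { component := M.component
    map := M.componentMap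
    map_refl g := by
      ext x
      apply DirectSum.of_injective (β := M.component) g
      rw [M.of_componentMap _ (one_mul g)]
      exact one_smul _ _
    map_trans {g₁ g₂ g₃} h₁ h₂ := by
      ext x
      apply DirectSum.of_injective (β := M.component) g₃
      obtain ⟨a, ha⟩ := id h₁
      obtain ⟨b, hb⟩ := id h₂
      rw [LinearMap.comp_apply, M.of_componentMap h₂ hb, M.of_componentMap h₁ ha, smul_smul,
        MonoidAlgebra.single_mul_single, one_mul,
        M.of_componentMap (c := b * a) _ (by rw [mul_assoc, ha, hb])] }

/-- With the family and its group structures held fixed, equality of objects reduces to equality of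
scalar multiplications. -/
theorem ext_of_smul_eq {C : G → Type w} [A : ∀ g, AddCommGroup (C g)]
    {m m' : Module (MonoidAlgebra R G) (⨁ g, C g)} (h h')
    (hm : ∀ (a : MonoidAlgebra R G) (x : ⨁ g, C g), m.smul a x = m'.smul a x) :
    (@GradedMonoidRingModule.mk R G _ _ C A m h) = @GradedMonoidRingModule.mk R G _ _ C A m' h' := by
  have : m = m' := Module.ext' _ _ hm
  subst this
  rfl

theorem toGraded_toPersistence [IsRightCancelMul G] (M : GradedMonoidRingModule.{u, v, w} R G) :
    M.toPersistence.toGraded = M := by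
  refine ext_of_smul_eq _ _ fun a x => ?_
  -- Linearity of the identity map between the two module structures is the required equality; it
  -- need only be tested on monomials and homogeneous elements.
  refine map_smul_of_map_single_smul_of (M := M.toPersistence.toGraded) (N := M)
    (AddMonoidHom.id _) (fun c r g x => ?_) a x
  refine (M.toPersistence.toGraded_single_smul_of c r g x).trans ?_
  refine (M.of_componentModule_smul _ _ _).trans ?_
  refine (congrArg _ (M.of_componentMap _ rfl _)).trans ?_
  rw [smul_smul, MonoidAlgebra.single_mul_single, one_mul, mul_one]
  rfl

end GradedMonoidRingModule

namespace GenPersistenceModule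

theorem ext_of_map_eq {C : G → Type w} [A : ∀ g, AddCommGroup (C g)]
    {m m' : ∀ g, Module R (C g)}
    {f : ∀ {g₁ g₂ : G}, LeftMultiple g₁ g₂ → (letI := m; C g₁ →ₗ[R] C g₂)}
    {f' : ∀ {g₁ g₂ : G}, LeftMultiple g₁ g₂ → (letI := m'; C g₁ →ₗ[R] C g₂)} (h₁ h₂ h₁' h₂')
    (hm : ∀ g (a : R) (x : C g), (m g).smul a x = (m' g).smul a x)
    (hf : ∀ {g₁ g₂ : G} (h : LeftMultiple g₁ g₂) (x : C g₁), f h x = f' h x) :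
    (@GenPersistenceModule.mk R G _ _ C A m @f h₁ h₂) =
      @GenPersistenceModule.mk R G _ _ C A m' @f' h₁' h₂' := by
  have : m = m' := funext fun g => Module.ext' _ _ (hm g)
  subst this
  have : @f = @f' := by
    funext g₁ g₂ h
    exact LinearMap.ext (hf h)
  subst this
  rfl

theorem toPersistence_toGraded [IsRightCancelMul G] (P : GenPersistenceModule.{u, v, w} R G) :
    P.toGraded.toPersistence = P := by
  refine ext_of_map_eq _ _ _ _ (fun g a x => ?_) (fun {g₁ g₂} h x => ?_)
  · apply DirectSum.of_injective (β := P.component) g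
    refine (P.toGraded.of_componentModule_smul g a x).trans ?_
    exact P.toGraded_single_one_smul_of a g x
  · apply DirectSum.of_injective (β := P.component) g₂
    obtain ⟨c, rfl⟩ := id h
    refine (P.toGraded.of_componentMap h rfl x).trans ?_
    refine (P.toGraded_single_smul_of c 1 g₁ x).trans ?_
    rw [one_smul]
    rfl

end GenPersistenceModule

/-! ### Morphisms and functors -/

namespace GradedMonoidRingModule

/-- Equality of functors compares morphisms whose sources and targets are only propositionally
equal. Since the families are shared, the module structures can be substituted away. -/
theorem Hom.heq_of_apply_eq {C D : G → Type w} [∀ g, AddCommGroup (C g)] [∀ g, AddCommGroup (D g)]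
    {m m' : Module (MonoidAlgebra R G) (⨁ g, C g)} {n n' : Module (MonoidAlgebra R G) (⨁ g, D g)}
    {h₁ h₁' h₂ h₂'}
    (hm : @GradedMonoidRingModule.mk R G _ _ C _ m h₁ =
      @GradedMonoidRingModule.mk R G _ _ C _ m' h₁')
    (hn : @GradedMonoidRingModule.mk R G _ _ D _ n h₂ =
      @GradedMonoidRingModule.mk R G _ _ D _ n' h₂')
    (f : Hom (@GradedMonoidRingModule.mk R G _ _ C _ m h₁)
      (@GradedMonoidRingModule.mk R G _ _ D _ n h₂))
    (f' : Hom (@GradedMonoidRingModule.mk R G _ _ C _ m' h₁')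
      (@GradedMonoidRingModule.mk R G _ _ D _ n' h₂'))
    (hf : ∀ x : ⨁ g, C g, f.toLinearMap x = f'.toLinearMap x) : HEq f f' := by
  have hm : m = m' := by simpa using hm
  have hn : n = n' := by simpa using hn
  subst hm hn
  exact heq_of_eq (Hom.ext (LinearMap.ext hf))

end GradedMonoidRingModule

namespace GenPersistenceModule

theorem Hom.heq_of_apply_eq {C D : G → Type w} [A : ∀ g, AddCommGroup (C g)]
    [B : ∀ g, AddCommGroup (D g)] {m m' : ∀ g, Module R (C g)} {n n' : ∀ g, Module R (D g)}
    {k k' l l' h₁ h₁' h₂ h₂' i₁ i₁' i₂ i₂'}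
    (hm : @GenPersistenceModule.mk R G _ _ C A m k h₁ h₂ =
      @GenPersistenceModule.mk R G _ _ C A m' k' h₁' h₂')
    (hn : @GenPersistenceModule.mk R G _ _ D B n l i₁ i₂ =
      @GenPersistenceModule.mk R G _ _ D B n' l' i₁' i₂')
    (f : Hom (@GenPersistenceModule.mk R G _ _ C A m k h₁ h₂)
      (@GenPersistenceModule.mk R G _ _ D B n l i₁ i₂))
    (f' : Hom (@GenPersistenceModule.mk R G _ _ C A m' k' h₁' h₂')
      (@GenPersistenceModule.mk R G _ _ D B n' l' i₁' i₂'))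
    (hf : ∀ g (x : C g), f.app g x = f'.app g x) : HEq f f' := by
  obtain ⟨hm, hk⟩ : m = m' ∧ HEq @k @k' := by simpa using hm
  obtain ⟨hn, hl⟩ : n = n' ∧ HEq @l @l' := by simpa using hn
  subst hm hn
  obtain rfl := eq_of_heq hk
  obtain rfl := eq_of_heq hl
  exact heq_of_eq (Hom.ext (funext fun g => LinearMap.ext (hf g)))

theorem Hom.app_map {P Q : GenPersistenceModule.{u, v, w} R G} (ξ : Hom P Q) {g₁ g₂ : G}
    (h : LeftMultiple g₁ g₂) (x : P.component g₁) :
    ξ.app g₂ (P.map h x) = Q.map h (ξ.app g₁ x) :=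
  (LinearMap.congr_fun (ξ.naturality h) x).symm

theorem Hom.map_app_single_smul_of {P Q : GenPersistenceModule.{u, v, w} R G} (ξ : Hom P Q)
    (c : G) (r : R) (g : G) (x : P.component g) :
    letI := P.monoidAlgebraModule
    letI := Q.monoidAlgebraModule
    DirectSum.map (fun g => (ξ.app g).toAddMonoidHom)
        ((MonoidAlgebra.single c r : MonoidAlgebra R G) • DirectSum.of P.component g x) =
      (MonoidAlgebra.single c r : MonoidAlgebra R G) •
        DirectSum.map (fun g => (ξ.app g).toAddMonoidHom) (DirectSum.of P.component g x) := by
  rw [single_smul_of, DirectSum.map_of, DirectSum.map_of, single_smul_of,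
    LinearMap.toAddMonoidHom_coe, LinearMap.toAddMonoidHom_coe, LinearMap.map_smul, ξ.app_map]

/-- The graded morphism induced by a morphism of persistence modules. -/
noncomputable def Hom.toGraded {P Q : GenPersistenceModule.{u, v, w} R G} (ξ : Hom P Q) :
    GradedMonoidRingModule.Hom P.toGraded Q.toGraded where
  toLinearMap :=
    { DirectSum.map fun g => (ξ.app g).toAddMonoidHom with
      map_smul' := GradedMonoidRingModule.map_smul_of_map_single_smul_of
        (M := P.toGraded) (N := Q.toGraded) _ ξ.map_app_single_smul_of }
  map_homogeneous g x hx h hh := by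
    change ξ.app h (x h) = 0
    exact (congrArg _ (hx h hh)).trans (LinearMap.map_zero _)

/-- The functor from persistence modules to graded modules. -/
noncomputable def toGradedFunctor (R : Type u) (G : Type v) [Ring R] [Monoid G] :
    GenPersistenceModule.{u, v, w} R G ⥤ GradedMonoidRingModule.{u, v, w} R G where
  obj := toGraded
  map := Hom.toGraded
  map_id _ := GradedMonoidRingModule.Hom.ext (LinearMap.ext fun _ => DFinsupp.ext fun _ => rfl)
  map_comp _ _ :=
    GradedMonoidRingModule.Hom.ext (LinearMap.ext fun _ => DFinsupp.ext fun _ => rfl)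

end GenPersistenceModule

namespace GradedMonoidRingModule

theorem Hom.of_apply_of {M N : GradedMonoidRingModule.{u, v, w} R G} (f : Hom M N) (g : G)
    (x : M.component g) :
    DirectSum.of N.component g (f.toLinearMap (DirectSum.of M.component g x) g) =
      f.toLinearMap (DirectSum.of M.component g x) :=
  (f.map_homogeneous g _ (isHomogeneousOfDegree_of g x)).of_apply_eq

/-- The component of a graded morphism in a given degree. -/
noncomputable def Hom.componentMap {M N : GradedMonoidRingModule.{u, v, w} R G} (f : Hom M N)
    (g : G) :
    letI := M.componentModule g
    letI := N.componentModule g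
    M.component g →ₗ[R] N.component g :=
  letI := M.componentModule g
  letI := N.componentModule g
  { toFun x := f.toLinearMap (DirectSum.of M.component g x) g
    map_add' x y := by rw [map_add, map_add, DirectSum.add_apply]
    map_smul' r x := by
      apply DirectSum.of_injective (β := N.component) g
      rw [f.of_apply_of, of_componentModule_smul, RingHom.id_apply, of_componentModule_smul,
        map_smul, f.of_apply_of] }

/-- The morphism of persistence modules formed by the components of a graded morphism. -/
noncomputable def Hom.toPersistence [IsRightCancelMul G]
    {M N : GradedMonoidRingModule.{u, v, w} R G} (f : Hom M N) :
    GenPersistenceModule.Hom M.toPersistence N.toPersistence where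
  app := f.componentMap
  naturality {g k} h := by
    refine LinearMap.ext fun x => ?_
    apply DirectSum.of_injective (β := N.component) k
    obtain ⟨c, hc⟩ := id h
    refine (N.of_componentMap h hc _).trans ?_
    refine Eq.trans ?_ (f.of_apply_of k _).symm
    refine Eq.trans ?_ (congrArg _ (M.of_componentMap h hc x)).symm
    rw [map_smul]
    exact congrArg _ (f.of_apply_of g x)

/-- The functor from graded modules to persistence modules. -/
noncomputable def toPersistenceFunctor (R : Type u) (G : Type v) [Ring R] [Monoid G]
    [IsRightCancelMul G] :
    GradedMonoidRingModule.{u, v, w} R G ⥤ GenPersistenceModule.{u, v, w} R G where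
  obj := toPersistence
  map := Hom.toPersistence
  map_id M := GenPersistenceModule.Hom.ext (funext fun g => LinearMap.ext fun x =>
    DirectSum.of_eq_same (β := M.component) g x)
  map_comp f f' := GenPersistenceModule.Hom.ext (funext fun g => LinearMap.ext fun x =>
    congrArg (fun y => f'.toLinearMap y g) (f.of_apply_of g x).symm)

theorem toPersistenceFunctor_comp_toGradedFunctor (R : Type u) (G : Type v) [Ring R] [Monoid G]
    [IsRightCancelMul G] :
    toPersistenceFunctor.{u, v, w} R G ⋙ GenPersistenceModule.toGradedFunctor R G = 𝟭 _ := by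
  refine Functor.hext toGraded_toPersistence fun M N f => ?_
  refine Hom.heq_of_apply_eq (C := M.component) (D := N.component) (toGraded_toPersistence M)
    (toGraded_toPersistence N) _ f fun x => ?_
  induction x using DirectSum.induction_on with
  | zero => exact (map_zero _).trans (map_zero _).symm
  | of g x => exact (DirectSum.map_of _ g x).trans (f.of_apply_of g x)
  | add x y hx hy =>
    exact (map_add _ x y).trans ((congrArg₂ _ hx hy).trans (map_add _ x y).symm)

theorem toGradedFunctor_comp_toPersistenceFunctor (R : Type u) (G : Type v) [Ring R] [Monoid G]
    [IsRightCancelMul G] :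
    GenPersistenceModule.toGradedFunctor.{u, v, w} R G ⋙ toPersistenceFunctor R G = 𝟭 _ := by
  refine Functor.hext GenPersistenceModule.toPersistence_toGraded fun P Q ξ => ?_
  refine GenPersistenceModule.Hom.heq_of_apply_eq P.toPersistence_toGraded
    Q.toPersistence_toGraded _ ξ fun g x => ?_
  refine (congrArg (fun y : ⨁ g, Q.component g => y g)
    (DirectSum.map_of (fun g => (ξ.app g).toAddMonoidHom) g x)).trans ?_
  exact DirectSum.of_eq_same (β := Q.component) g _

end GradedMonoidRingModule

end CorrespondenceOfCategories

/-! ### Restriction to full subcategories -/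

theorem CategoryTheory.ObjectProperty.functor_ext_of_comp_ι_eq {C D : Type*} [Category* C]
    [Category* D] {P : ObjectProperty D} {F F' : C ⥤ P.FullSubcategory}
    (h : F ⋙ P.ι = F' ⋙ P.ι) : F = F' :=
  Functor.ext (fun X => ObjectProperty.FullSubcategory.ext (Functor.congr_obj h X)) fun X Y f =>
    P.ι.map_injective (by simpa [eqToHom_map] using Functor.congr_hom h f)

/-- Since `X = F'.obj (F.obj X)`, the comparison of properties along `F'` also gives the one along
`F`. -/
theorem AreIsomorphicCategories.fullSubcategory {C D : Type*} [Category* C] [Category* D]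
    {F : C ⥤ D} {F' : D ⥤ C} (h : F ⋙ F' = 𝟭 C) (h' : F' ⋙ F = 𝟭 D) {P : ObjectProperty C}
    {Q : ObjectProperty D} (hQ : ∀ Y, P (F'.obj Y) ↔ Q Y) :
    AreIsomorphicCategories P.FullSubcategory Q.FullSubcategory := by
  have hP : ∀ X, P X → Q (F.obj X) := fun X hX => by
    rw [← hQ]
    exact (Functor.congr_obj h X).symm ▸ hX
  refine ⟨Q.lift (P.ι ⋙ F) fun X => hP _ X.property,
    P.lift (Q.ι ⋙ F') fun Y => (hQ _).2 Y.property, ?_, ?_⟩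
  · exact ObjectProperty.functor_ext_of_comp_ι_eq (congrArg (P.ι ⋙ ·) h)
  · exact ObjectProperty.functor_ext_of_comp_ι_eq (congrArg (Q.ι ⋙ ·) h')

/-! ### Divisibility in good monoids -/

section Framing

variable {G : Type v} [Monoid G]

/-- Over a nontrivial ring, if the monoid ring is left Noetherian then every nonempty set has an
element that is minimal for divisibility. -/
theorem exists_minimal_leftMultiple_of_isNoetherianRing (R : Type u) [Ring R] [Nontrivial R]
    [IsNoetherianRing (MonoidAlgebra R G)]
    (hanti : ∀ g₁ g₂ : G, LeftMultiple g₁ g₂ → LeftMultiple g₂ g₁ → g₁ = g₂)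
    {T : Set G} (hT : T.Nonempty) :
    ∃ h ∈ T, ∀ h' ∈ T, LeftMultiple h' h → h' = h := by
  let I : G → Submodule (MonoidAlgebra R G) (MonoidAlgebra R G) :=
    fun g => Submodule.span _ {MonoidAlgebra.single g 1}
  have hI : ∀ {g k : G}, I k ≤ I g → LeftMultiple g k := fun {g k} hle => by
    obtain ⟨a, ha⟩ := Submodule.mem_span_singleton.1
      (hle (Submodule.mem_span_singleton_self (MonoidAlgebra.single k (1 : R))))
    by_contra hgk
    -- If `k` is not a multiple of `g`, the coefficient of `a X^g` at `k` vanishes, while that of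
    -- `X^k` is `1 ≠ 0`.
    have h0 := MonoidAlgebra.coeff_mul_single_of_forall_mul_ne (1 : R) a
      (fun d hd => hgk ⟨d, hd⟩ : ∀ d, d * g ≠ k)
    rw [← smul_eq_mul, ha] at h0
    simp at h0
  have hI' : ∀ {g k : G}, LeftMultiple g k → I k ≤ I g := by
    rintro g _ ⟨c, rfl⟩
    refine (Submodule.span_singleton_le_iff_mem _ _).2 (Submodule.mem_span_singleton.2
      ⟨MonoidAlgebra.single c 1, ?_⟩)
    rw [smul_eq_mul, MonoidAlgebra.single_mul_single, one_mul]
  -- Divisibility reverses inclusion of the left ideals `I g`, so a maximal ideal among them gives a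
  -- minimal element of `T`.
  obtain ⟨_, ⟨h, hhT, rfl⟩, hmax⟩ := WellFounded.has_min
    (wellFounded_gt : WellFounded (· > · : Submodule (MonoidAlgebra R G) (MonoidAlgebra R G) → _))
    (I '' T) (hT.image I)
  refine ⟨h, hhT, fun h' hh' hle => hanti _ _ hle (hI ?_)⟩
  by_contra hnot
  exact hmax _ ⟨h', hh', rfl⟩ (lt_of_le_not_ge (hI' hle) hnot)

/-- In a good monoid with left Noetherian monoid ring, the elements below which the divisors from
a given finite set are the same can be represented by finitely many elements. -/
theorem IsGoodMonoid.exists_finite_set_of_divisors (hG : IsGoodMonoid G) (R : Type u) [Ring R]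
    [Nontrivial R] [IsNoetherianRing (MonoidAlgebra R G)] {E : Set G} (hE : E.Finite) :
    ∃ H : Set G, H.Finite ∧ ∀ g, ∃ h ∈ H, LeftMultiple h g ∧
      ∀ e ∈ E, LeftMultiple e g → LeftMultiple e h := by
  refine ⟨⋃ S ∈ 𝒫 E, {h | IsPartiallyLeastCommonMultiple S h},
    hE.finite_subsets.biUnion fun S hS => hG.weak_plcm S (hE.subset hS), fun g => ?_⟩
  let S : Set G := {e ∈ E | LeftMultiple e g}
  obtain ⟨h, ⟨hhS, hhg⟩, hmin⟩ := exists_minimal_leftMultiple_of_isNoetherianRing R hG.antisymm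
    (T := {h | IsCommonMultiple S h ∧ LeftMultiple h g}) ⟨g, fun e he => he.2, LeftMultiple.refl g⟩
  -- Minimality among the common multiples dividing `g` is minimality among all of them, because
  -- anything below `h` divides `g`.
  refine ⟨h, Set.mem_biUnion (x := S) (fun e he => he.1) ⟨hhS, fun h' hh' hne => ?_⟩, hhg,
    fun e he heg => hhS e ⟨he, heg⟩⟩
  exact hne.2 (hmin h' ⟨hh', hne.1.trans hhg⟩ hne.1)

end Framing

/-! ### Monotone families of relations -/

section MonotoneFamilies

variable {R : Type u} {G : Type v} [Ring R] [Monoid G] {ι : Type*}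

/-- The vectors over the monoid ring whose coefficients in each degree lie in the given member of
a monotone family of submodules. -/
def gradedSubmodule [IsLeftCancelMul G] (K : G → Submodule R (ι → R))
    (hK : ∀ g k, LeftMultiple g k → K g ≤ K k) :
    Submodule (MonoidAlgebra R G) (ι → MonoidAlgebra R G) where
  carrier := {y | ∀ g, (fun i => (y i).coeff g) ∈ K g}
  add_mem' hx hy g := (K g).add_mem (hx g) (hy g)
  zero_mem' g := (K g).zero_mem
  smul_mem' a y hy := by
    induction a using MonoidAlgebra.induction_linear with
    | zero =>
      intro g
      rw [zero_smul]
      exact (K g).zero_mem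
    | add a b ha hb =>
      intro g
      rw [add_smul]
      exact (K g).add_mem (ha g) (hb g)
    | single c r =>
      intro g
      simp only [Pi.smul_apply, smul_eq_mul]
      -- By left cancellation, the coefficient of `r X^c y` at `c * k` involves only the coefficient
      -- of `y` at `k`; in degrees that are not of the form `c * k` it is zero.
      by_cases h : ∃ k, c * k = g
      · obtain ⟨k, rfl⟩ := h
        simp only [MonoidAlgebra.coeff_single_mul_eq_mul_coeff k
          fun _ _ => mul_right_inj c]
        exact hK k _ (LeftMultiple.mul_left c k) ((K k).smul_mem r (hy k))
      · simp only [MonoidAlgebra.coeff_single_mul_of_forall_mul_ne r _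
          fun d hd => h ⟨d, hd⟩]
        exact (K g).zero_mem

/-- If the monoid ring is left Noetherian, then a monotone family of submodules of a free module
of finite rank is generated in finitely many degrees. -/
theorem exists_finite_forall_le_iSup [Finite ι] [IsLeftCancelMul G]
    [IsNoetherianRing (MonoidAlgebra R G)] (K : G → Submodule R (ι → R))
    (hK : ∀ g k, LeftMultiple g k → K g ≤ K k) :
    ∃ E : Set G, E.Finite ∧ ∀ g, K g ≤ ⨆ e ∈ E, ⨆ _ : LeftMultiple e g, K e := by
  classical
  obtain ⟨S, hS⟩ := IsNoetherian.noetherian (gradedSubmodule K hK)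
  let E : Set G := ⋃ y ∈ S, ⋃ i, (y i).coeff.support
  let K' : G → Submodule R (ι → R) := fun g => ⨆ e ∈ E, ⨆ _ : LeftMultiple e g, K e
  have hK' : ∀ g k, LeftMultiple g k → K' g ≤ K' k := fun g k hgk =>
    iSup₂_mono fun e _ => iSup_le fun heg => le_iSup_of_le (heg.trans hgk) le_rfl
  refine ⟨E, S.finite_toSet.biUnion fun y _ => Set.finite_iUnion fun i =>
    (y i).coeff.support.finite_toSet, fun g z hz => ?_⟩
  -- `E` consists of the degrees occurring in the generators `S`. There `K` and `K'` agree, and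
  -- elsewhere the coefficients of the generators vanish.
  have hle : gradedSubmodule K hK ≤ gradedSubmodule K' hK' := by
    rw [← hS, Submodule.span_le]
    intro y hy g
    by_cases hg : g ∈ E
    · have : K g ≤ K' g := le_iSup₂_of_le g hg (le_iSup_of_le (LeftMultiple.refl g) le_rfl)
      exact this ((hS ▸ Submodule.subset_span hy : y ∈ gradedSubmodule K hK) g)
    · have : (fun i => (y i).coeff g) = 0 := by
        funext i
        by_contra hne
        exact hg (Set.mem_biUnion hy (Set.mem_iUnion.2 ⟨i, Finsupp.mem_support_iff.2 hne⟩))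
      rw [this]
      exact (K' g).zero_mem
  -- The vector `z` of `K g` is placed in degree `g`, where `hle` then reads it off in `K' g`.
  have hmem : (fun i => MonoidAlgebra.single g (z i)) ∈ gradedSubmodule K hK := by
    intro k
    by_cases hk : g = k
    · subst hk
      simpa using hz
    · have : (fun i => (MonoidAlgebra.single g (z i)).coeff k) = 0 := by
        funext i
        simp [hk]
      rw [this]
      exact (K k).zero_mem
  simpa using hle hmem g

end MonotoneFamilies

/-! ### Finite generation and finite framing sets -/

namespace GenPersistenceModule

open scoped Classical

variable {R : Type u} {G : Type v} [Ring R] [Monoid G] (P : GenPersistenceModule.{u, v, w} R G)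

/-- The direct sum of a family of submodules that is stable under the connecting maps. -/
noncomputable def directSumSubmodule (N : ∀ g, Submodule R (P.component g))
    (hN : ∀ {g k} (h : LeftMultiple g k), ∀ x ∈ N g, P.map h x ∈ N k) :
    letI := P.monoidAlgebraModule
    Submodule (MonoidAlgebra R G) (⨁ g, P.component g) :=
  letI := P.monoidAlgebraModule
  { carrier := {x | ∀ g, x g ∈ N g}
    add_mem' := fun hx hy g => (N g).add_mem (hx g) (hy g)
    zero_mem' := fun g => (N g).zero_mem
    smul_mem' := fun a x hx => by
      induction a using MonoidAlgebra.induction_linear with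
      | zero =>
        intro g
        rw [zero_smul]
        exact (N g).zero_mem
      | add a b ha hb =>
        intro g
        rw [add_smul]
        exact (N g).add_mem (ha g) (hb g)
      | single c r =>
        intro k
        rw [← DirectSum.sum_support_of x, Finset.smul_sum, DFinsupp.finsetSum_apply]
        refine (N k).sum_mem fun g _ => ?_
        rw [single_smul_of]
        by_cases hk : k = c * g
        · subst hk
          rw [DirectSum.of_eq_same]
          exact (N _).smul_mem r (hN _ _ (hx g))
        · rw [DirectSum.of_eq_of_ne _ _ _ hk]
          exact (N k).zero_mem }

/-- If the direct sum of a persistence module is finitely generated over the monoid ring, then the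
persistence module is generated by finitely many homogeneous elements. -/
theorem exists_finite_generators
    (hP : GradedMonoidRingModule.finitelyGenerated.{u, v, w} R G P.toGraded) :
    ∃ T : Set (Σ g, P.component g), T.Finite ∧
      ∀ g, Submodule.span R {y | ∃ t ∈ T, ∃ h : LeftMultiple t.1 g, P.map h t.2 = y} = ⊤ := by
  let := P.monoidAlgebraModule
  obtain ⟨S, hS⟩ : (⊤ : Submodule (MonoidAlgebra R G) (⨁ g, P.component g)).FG := hP.fg_top
  -- The nonzero homogeneous components of the given generators.
  let T : Set (Σ g, P.component g) :=
    ⋃ x ∈ S, (fun g => ⟨g, x g⟩) '' (DFinsupp.support x : Set G)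
  let N : ∀ g, Submodule R (P.component g) := fun g =>
    Submodule.span R {y | ∃ t ∈ T, ∃ h : LeftMultiple t.1 g, P.map h t.2 = y}
  have hN : ∀ {g k} (h : LeftMultiple g k), ∀ x ∈ N g, P.map h x ∈ N k := by
    intro g k h x hx
    refine (Submodule.span_le.2 ?_ : N g ≤ (N k).comap (P.map h)) hx
    rintro _ ⟨t, ht, htg, rfl⟩
    exact Submodule.subset_span ⟨t, ht, htg.trans h, (P.map_map htg h t.2).symm⟩
  have htop : P.directSumSubmodule N hN = ⊤ := by
    rw [← top_le_iff, ← hS, Submodule.span_le]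
    intro x hx g
    by_cases hg : x g = 0
    · rw [hg]
      exact (N g).zero_mem
    · exact Submodule.subset_span ⟨⟨g, x g⟩,
        Set.mem_biUnion hx ⟨g, DFinsupp.mem_support_iff.2 hg, rfl⟩, LeftMultiple.refl g,
        P.map_self _ _⟩
  refine ⟨T, S.finite_toSet.biUnion fun x _ => (Finset.finite_toSet _).image _, fun g => ?_⟩
  rw [eq_top_iff]
  intro x _
  have hx : DirectSum.of P.component g x ∈ P.directSumSubmodule N hN := htop ▸ Submodule.mem_top
  have := hx g
  rwa [DirectSum.of_eq_same] at this

section Generators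

variable {ι : Type*} [Fintype ι] (d : ι → G) (m : ∀ i, P.component (d i))

/-- The image in degree `g` of a family of homogeneous elements, zero where undefined. -/
noncomputable def generator (g : G) (i : ι) : P.component g :=
  if h : LeftMultiple (d i) g then P.map h (m i) else 0

/-- The linear combination in degree `g` of a family of homogeneous elements. -/
noncomputable def combination (g : G) : (ι → R) →ₗ[R] P.component g :=
  Fintype.linearCombination R (P.generator d m g)

/-- The vectors supported on the indices of degree dividing `g`. -/
def supportedBelow (R : Type u) [Ring R] (g : G) : Submodule R (ι → R) where
  carrier := {y | ∀ i, ¬ LeftMultiple (d i) g → y i = 0}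
  add_mem' hx hy i hi := by rw [Pi.add_apply, hx i hi, hy i hi, add_zero]
  zero_mem' _ _ := rfl
  smul_mem' r y hy i hi := by rw [Pi.smul_apply, hy i hi, smul_zero]

/-- The relations in degree `g` between a family of homogeneous elements. -/
noncomputable def relations (g : G) : Submodule R (ι → R) :=
  supportedBelow d R g ⊓ LinearMap.ker (P.combination d m g)

variable {d m}

theorem combination_apply (g : G) (y : ι → R) :
    P.combination d m g y = ∑ i, y i • P.generator d m g i :=
  Fintype.linearCombination_apply ..

theorem map_combination {g k : G} (h : LeftMultiple g k) {y : ι → R}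
    (hy : y ∈ supportedBelow d R g) :
    P.map h (P.combination d m g y) = P.combination d m k y := by
  rw [combination_apply, combination_apply, map_sum]
  refine Finset.sum_congr rfl fun i _ => ?_
  by_cases hi : LeftMultiple (d i) g
  · rw [map_smul, generator, generator, dif_pos hi, dif_pos (hi.trans h), map_map]
  · rw [hy i hi, zero_smul, zero_smul, map_zero]

/-- The support condition is essential: a generator whose degree does not divide `g` has default
value zero at `g` but may be nonzero at `k`, so the kernels alone need not increase. -/
theorem relations_mono {g k : G} (h : LeftMultiple g k) :
    P.relations d m g ≤ P.relations d m k := by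
  intro y hy
  refine ⟨fun i hi => hy.1 i fun hig => hi (hig.trans h), ?_⟩
  refine LinearMap.mem_ker.2 ?_
  rw [← P.map_combination h hy.1, LinearMap.mem_ker.1 hy.2, map_zero]

theorem exists_combination_eq {g : G}
    (hm : Submodule.span R (Set.range (P.generator d m g)) = ⊤) (x : P.component g) :
    ∃ y ∈ supportedBelow d R g, P.combination d m g y = x := by
  obtain ⟨y, rfl⟩ : ∃ y, P.combination d m g y = x := by
    rw [← LinearMap.mem_range, combination, Fintype.range_linearCombination, hm]
    exact Submodule.mem_top
  refine ⟨fun i => if LeftMultiple (d i) g then y i else 0, fun i hi => if_neg hi, ?_⟩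
  rw [combination_apply, combination_apply]
  refine Finset.sum_congr rfl fun i _ => ?_
  split_ifs with hi
  · rfl
  · rw [generator, dif_neg hi, smul_zero, smul_zero]

/-- Both components are quotients of supported vectors by relations. No new generators between `h`
and `k` gives surjectivity, and no new relations gives injectivity. -/
theorem bijective_map_of_generators
    (hm : ∀ g, Submodule.span R (Set.range (P.generator d m g)) = ⊤) {h k : G}
    (hk : LeftMultiple h k) (hd : ∀ i, LeftMultiple (d i) k → LeftMultiple (d i) h)
    (hrel : P.relations d m k ≤ P.relations d m h) : Function.Bijective (P.map hk) := by
  constructor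
  · rw [injective_iff_map_eq_zero]
    intro x hx
    obtain ⟨y, hy, rfl⟩ := P.exists_combination_eq (hm h) x
    rw [P.map_combination hk hy] at hx
    exact (hrel ⟨fun i hi => hy i fun hih => hi (hih.trans hk), hx⟩).2
  · intro x
    obtain ⟨y, hy, rfl⟩ := P.exists_combination_eq (hm k) x
    exact ⟨P.combination d m h y, P.map_combination hk fun i hi => hy i fun hik => hi (hd i hik)⟩

end Generators

/-- The zero ring is treated apart, since the minimality argument with left ideals needs `1 ≠ 0`. -/
theorem isFramingSet_one_of_subsingleton [Subsingleton R] : P.IsFramingSet {1} := fun g =>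
  ⟨1, rfl, ⟨g, mul_one g⟩, fun k _ _ =>
    have := Module.subsingleton R (P.component k)
    have := Module.subsingleton R (P.component 1)
    ⟨fun _ _ _ => Subsingleton.elim _ _, fun _ => ⟨0, Subsingleton.elim _ _⟩⟩⟩

theorem finitelyGeneratedType_of_finitelyGenerated_toGraded (hG : IsGoodMonoid G)
    [IsNoetherianRing (MonoidAlgebra R G)]
    (hP : GradedMonoidRingModule.finitelyGenerated.{u, v, w} R G P.toGraded) :
    finitelyGeneratedType.{u, v, w} R G P := by
  have := hG.cancel
  obtain ⟨T, hTfin, hT⟩ := P.exists_finite_generators hP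
  have := hTfin.fintype
  let d : T → G := fun t => t.1.1
  let m : ∀ t : T, P.component (d t) := fun t => t.1.2
  have hm : ∀ g, Submodule.span R (Set.range (P.generator d m g)) = ⊤ := by
    intro g
    rw [eq_top_iff, ← hT g]
    refine Submodule.span_mono ?_
    rintro _ ⟨t, ht, h, rfl⟩
    exact ⟨⟨t, ht⟩, dif_pos h⟩
  refine ⟨?_, fun g => ⟨Submodule.fg_def.2 ⟨_, Set.finite_range _, hm g⟩⟩⟩
  rcases subsingleton_or_nontrivial R with hR | hR
  · exact ⟨{1}, Set.finite_singleton 1, P.isFramingSet_one_of_subsingleton⟩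
  obtain ⟨E, hE, hEK⟩ := exists_finite_forall_le_iSup (P.relations d m)
    fun _ _ h => P.relations_mono h
  -- Degrees of generators and of relations are controlled together, so that both stabilise from the
  -- same `h` onwards.
  obtain ⟨H, hH, hHE⟩ := hG.exists_finite_set_of_divisors R ((Set.finite_range d).union hE)
  refine ⟨H, hH, fun g => ?_⟩
  obtain ⟨h, hhH, hhg, hh⟩ := hHE g
  refine ⟨h, hhH, hhg, fun k hhk hkg => P.bijective_map_of_generators hm hhk
    (fun i hi => hh _ (Or.inl ⟨i, rfl⟩) (hi.trans hkg)) ((hEK k).trans ?_)⟩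
  -- A degree `e` of `E` dividing `k` divides `g`, hence `h`, so its relations already hold at `h`.
  exact iSup₂_le fun e he => iSup_le fun hek =>
    P.relations_mono (hh e (Or.inr he) (hek.trans hkg))

theorem finitelyGenerated_toGraded_of_finitelyGeneratedType
    (hP : finitelyGeneratedType.{u, v, w} R G P) :
    GradedMonoidRingModule.finitelyGenerated.{u, v, w} R G P.toGraded := by
  let := P.monoidAlgebraModule
  obtain ⟨⟨H, hH, hframe⟩, hfin⟩ := hP
  choose S hS using fun g => (hfin g).fg_top
  let X : Set (⨁ g, P.component g) :=
    ⋃ h ∈ H, DirectSum.of P.component h '' (S h : Set (P.component h))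
  have hX : X.Finite := hH.biUnion fun h _ => (S h).finite_toSet.image _
  let N : Submodule (MonoidAlgebra R G) (⨁ g, P.component g) := Submodule.span _ X
  have hgen : ∀ h ∈ H, ∀ x, DirectSum.of P.component h x ∈ N := by
    intro h hh x
    have hx : x ∈ Submodule.span R (S h : Set (P.component h)) := hS h ▸ Submodule.mem_top
    induction hx using Submodule.span_induction with
    | mem x hx => exact Submodule.subset_span (Set.mem_biUnion hh ⟨x, hx, rfl⟩)
    | zero =>
      rw [map_zero]
      exact N.zero_mem
    | add x y _ _ hx hy =>
      rw [map_add]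
      exact N.add_mem hx hy
    | smul r x _ hx =>
      exact (P.toGraded_single_one_smul_of r h x) ▸ N.smul_mem (MonoidAlgebra.single 1 r) hx
  refine Module.Finite.of_fg_top (Submodule.fg_def.2 ⟨X, hX, ?_⟩)
  refine eq_top_iff.2 fun x _ => ?_
  change x ∈ N
  induction x using DirectSum.induction_on with
  | zero => exact N.zero_mem
  | add x y hx hy => exact N.add_mem (hx trivial) (hy trivial)
  | of g x =>
    obtain ⟨h, hh, hhg, hbij⟩ := hframe g
    -- Surjectivity of the map out of the frame makes every element of degree `g = c * h` a multiple
    -- by `X^c` of an element of degree `h`.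
    obtain ⟨y, rfl⟩ := (hbij g hhg (LeftMultiple.refl g)).2 x
    obtain ⟨c, rfl⟩ := id hhg
    have := N.smul_mem (MonoidAlgebra.single c 1) (hgen h hh y)
    rwa [single_smul_of, one_smul] at this

end GenPersistenceModule

theorem mainTheorem5 (R : Type u) (G : Type v) [Ring R] [Monoid G]
    (hG : IsGoodMonoid G) (hR : IsNoetherianRing R) (hRG : IsNoetherianRing (MonoidAlgebra R G)) :
    AreIsomorphicCategories
      (GradedMonoidRingModule.finitelyGenerated.{u, v, w} R G).FullSubcategory
      (GenPersistenceModule.finitelyGeneratedType.{u, v, w} R G).FullSubcategory := by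
  have := hG.cancel
  exact AreIsomorphicCategories.fullSubcategory
    (GradedMonoidRingModule.toPersistenceFunctor_comp_toGradedFunctor R G)
    (GradedMonoidRingModule.toGradedFunctor_comp_toPersistenceFunctor R G) fun P =>
      ⟨P.finitelyGeneratedType_of_finitelyGenerated_toGraded hG,
        P.finitelyGenerated_toGraded_of_finitelyGeneratedType⟩
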